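/- Theorem 7. Let $\mathcal A$ be a finite alphabet and let $d:\mathcal A\times\mathcal A\to[0,\infty)$ satisfy $d(x,x)=0$ for all $x$; for sequences put $d(\mathbf x,\mathbf y)=\sum_{i=1}^n d(x_i,y_i)$ (additive distortion). Let $\Delta_0,\Delta_1\ge 0$ and $a\in\mathbb R$, and let $P_0,P_1$ be probability mass functions on $\mathcal A$ such that some letter has positive probability under both (for instance, both of full support). Write $P_i(\mathbf x)=\prod_{j=1}^n P_i(x_j)$, let $\hat P_{\mathbf x}$ and $\hat P_{\mathbf x\mathbf y}$ be the (joint) types, i.e. empirical distributions, and let $\mathcal T(\mathbf y|\mathbf x)=\{\mathbf y':\hat P_{\mathbf x\mathbf y'}=\hat P_{\mathbf x\mathbf y}\}$. Let $\mathcal D(\cdot\|\cdot)\in[0,\infty]$ be the Kullback--Leibler divergence (natural logarithm). For $\Delta\ge0$ define the attack channel $A^*_\Delta(\mathbf y|\mathbf x)=c_n(\mathbf x)/|\mathcal T(\mathbf y|\mathbf x)|$ if $d(\mathbf x,\mathbf y)\le n\Delta$ and $A^*_\Delta(\mathbf y|\mathbf x)=0$ otherwise, where $1/c_n(\mathbf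 x)$ is the number of conditional type classes $\mathcal T(\mathbf y|\mathbf x)$ with $d(\mathbf x,\mathbf y)\le n\Delta$. For a sequence $\mathbf y\in\mathcal A^n$, for probability mass functions $P_Y$ and $P$ on $\mathcal A$, and for $\Delta\ge 0$, define $$\tilde{\mathcal D}^n_\Delta(\hat P_{\mathbf y},P)=\min_{\mathbf x\in\mathcal A^n:\ \sum_{i,j}\hat P_{\mathbf x\mathbf y}(i,j)d(i,j)\le\Delta}\mathcal D(\hat P_{\mathbf x}\|P),\qquad \tilde{\mathcal D}_\Delta(P_Y,P)=\min_{P_{X|Y}:\ E_{XY}d(X,Y)\le\Delta}\mathcal D(P_X\|P),$$ where in the second minimum the joint distribution is $P_{XY}=P_YP_{X|Y}$ and $P_X$ is its first marginal. Let $\Phi^\dagger(\mathcal H_1|\mathbf y)=U\big(\tilde{\mathcal D}^n_{\Delta_0}(\hat P_{\mathbf y},P_0)-\tilde{\mathcal D}^n_{\Delta_1}(\hat P_{\mathbf y},P_1)-a\big)$ with $U(t)=1$ for $t\ge0$ and $U(t)=0$ for $t<0$ (where both divergences are infinite, $\mathbf y$ has probability zero under both hypotheses and the value of $\Phi^\dagger$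 is immaterial), and $\Phi^\dagger(\mathcal H_0|\mathbf y)=1-\Phi^\dagger(\mathcal H_1|\mathbf y)$. Let $u_n=P_{\rm FN}+e^{an}P_{\rm FP}$ be the Bayes payoff at the profile $(\Phi^\dagger,(A^*_{\Delta_0},A^*_{\Delta_1}))$, where $$P_{\rm FN}=\sum_{\mathbf x,\mathbf y\in\mathcal A^n}P_1(\mathbf x)A^*_{\Delta_1}(\mathbf y|\mathbf x)\Phi^\dagger(\mathcal H_0|\mathbf y),\qquad P_{\rm FP}=\sum_{\mathbf x,\mathbf y\in\mathcal A^n}P_0(\mathbf x)A^*_{\Delta_0}(\mathbf y|\mathbf x)\Phi^\dagger(\mathcal H_1|\mathbf y).$$ Then $u_n>0$ for all $n\ge1$, the minimum below is attained and finite, the limit below exists, and $$-\lim_{n\to\infty}\frac1n\ln u_n=\min_{P_Y}\max\big\{\tilde{\mathcal D}_{\Delta_1}(P_Y,P_1),\ \tilde{\mathcal D}_{\Delta_0}(P_Y,P_0)-a\big\},$$ the minimum being over all probability mass functions $P_Y$ on $\mathcal A$. -/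

import Mathlib

open Filter Topology

namespace DetectionGame

noncomputable section

/-! Probability mass functions on a finite set `α` are the elements of `stdSimplex ℝ α`.
Sequences of length `n` over the alphabet `𝒜` are functions `Fin n → 𝒜`. -/

/-- Probability of the sequence `x` under the memoryless source with letter distribution `P`. -/
def sourceProb {𝒜 : Type*} {n : ℕ} (P : 𝒜 → ℝ) (x : Fin n → 𝒜) : ℝ :=
  ∏ i, P (x i)

open Classical in
/-- Kullback--Leibler divergence `D(P ‖ Q)` of two probability mass functions on a finite
alphabet, with the value `+∞` unless the support of `P` is contained in that of `Q`
(natural logarithm; a letter with `P x = 0` contributes `0`). -/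
def kl {𝒜 : Type*} [Fintype 𝒜] (P Q : 𝒜 → ℝ) : EReal :=
  if ∀ x, Q x = 0 → P x = 0 then ((∑ x, P x * Real.log (P x / Q x) : ℝ) : EReal) else ⊤

/-- First marginal of a joint probability mass function. -/
def margX {𝒜 : Type*} [Fintype 𝒜] (Q : 𝒜 × 𝒜 → ℝ) (x : 𝒜) : ℝ := ∑ y, Q (x, y)

/-- Second marginal of a joint probability mass function. -/
def margY {𝒜 : Type*} [Fintype 𝒜] (Q : 𝒜 × 𝒜 → ℝ) (y : 𝒜) : ℝ := ∑ x, Q (x, y)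

/-- Expectation of `d(X,Y)` under the joint probability mass function `Q`. -/
def expDist {𝒜 : Type*} [Fintype 𝒜] (d : 𝒜 → 𝒜 → ℝ) (Q : 𝒜 × 𝒜 → ℝ) : ℝ :=
  ∑ p, Q p * d p.1 p.2

/-- Number of indices `i` with `x i = a`. -/
def count {𝒜 : Type*} [DecidableEq 𝒜] {n : ℕ} (x : Fin n → 𝒜) (a : 𝒜) : ℕ :=
  (Finset.univ.filter fun i => x i = a).card

/-- The type (empirical distribution) of the sequence `x`. -/
def empType {𝒜 : Type*} [DecidableEq 𝒜] {n : ℕ} (x : Fin n → 𝒜) (a : 𝒜) : ℝ :=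
  (count x a : ℝ) / n

/-- The joint type of the pair of sequences `(x, y)`. -/
def jointType {𝒜 : Type*} [DecidableEq 𝒜] {n : ℕ} (x y : Fin n → 𝒜) : 𝒜 × 𝒜 → ℝ :=
  empType fun i => (x i, y i)

/-- The conditional type class `T(y|x)`: all `y'` such that `(x, y')` has the joint type
of `(x, y)`. -/
def condTypeClass {𝒜 : Type*} [Fintype 𝒜] [DecidableEq 𝒜] {n : ℕ} (x y : Fin n → 𝒜) :
    Finset (Fin n → 𝒜) :=
  Finset.univ.filter fun y' => jointType x y' = jointType x y

/-- The additive extension of a single-letter distortion to sequences. -/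
def seqDist {𝒜 : Type*} {n : ℕ} (d : 𝒜 → 𝒜 → ℝ) (x y : Fin n → 𝒜) : ℝ :=
  ∑ i, d (x i) (y i)

/-- `c_n(x)`: the reciprocal of the number of admissible conditional type classes `T(y|x)`,
i.e. those with `d(x, y) ≤ n Δ`. -/
def recipNumClasses {𝒜 : Type*} [Fintype 𝒜] [DecidableEq 𝒜] {n : ℕ} (d : 𝒜 → 𝒜 → ℝ) (Δ : ℝ)
    (x : Fin n → 𝒜) : ℝ :=
  (((Finset.univ.filter fun y : Fin n → 𝒜 => seqDist d x y ≤ n * Δ).image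
    (condTypeClass x)).card : ℝ)⁻¹

/-- The attack channel `A*_Δ(y|x)`: choose uniformly an admissible conditional type class
given `x`, then choose `y` uniformly in it. -/
def attackChannel {𝒜 : Type*} [Fintype 𝒜] [DecidableEq 𝒜] {n : ℕ} (d : 𝒜 → 𝒜 → ℝ) (Δ : ℝ)
    (x y : Fin n → 𝒜) : ℝ :=
  if seqDist d x y ≤ n * Δ then recipNumClasses d Δ x / (condTypeClass x y).card else 0

/-- Distribution of the channel output `y` when the channel `A`, with `A x y = A(y|x)`, is fed
by the memoryless source `P`. -/
def outputProb {𝒜 : Type*} [Fintype 𝒜] {n : ℕ} (P : 𝒜 → ℝ)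
    (A : (Fin n → 𝒜) → (Fin n → 𝒜) → ℝ) (y : Fin n → 𝒜) : ℝ :=
  ∑ x, sourceProb P x * A x y

/-- False positive probability of the randomized decision rule `Φ`, where `Φ y` is the
probability `Φ(H₁|y)` of deciding in favour of `H₁` given `y`. -/
def probFP {𝒜 : Type*} [Fintype 𝒜] {n : ℕ} (P₀ : 𝒜 → ℝ) (Φ : (Fin n → 𝒜) → ℝ)
    (A₀ : (Fin n → 𝒜) → (Fin n → 𝒜) → ℝ) : ℝ :=
  ∑ y, outputProb P₀ A₀ y * Φ y

/-- False negative probability of the randomized decision rule `Φ`; `1 - Φ y` is the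
probability `Φ(H₀|y)` of deciding in favour of `H₀` given `y`. -/
def probFN {𝒜 : Type*} [Fintype 𝒜] {n : ℕ} (P₁ : 𝒜 → ℝ) (Φ : (Fin n → 𝒜) → ℝ)
    (A₁ : (Fin n → 𝒜) → (Fin n → 𝒜) → ℝ) : ℝ :=
  ∑ y, outputProb P₁ A₁ y * (1 - Φ y)

/-- The payoff of the Bayesian detection game, `P_FN(Φ, A₁) + e^{an} P_FP(Φ, A₀)`. -/
def bayesPayoff {𝒜 : Type*} [Fintype 𝒜] {n : ℕ} (P₀ P₁ : 𝒜 → ℝ) (a : ℝ)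
    (Φ : (Fin n → 𝒜) → ℝ) (A₀ A₁ : (Fin n → 𝒜) → (Fin n → 𝒜) → ℝ) : ℝ :=
  probFN P₁ Φ A₁ + Real.exp (a * n) * probFP P₀ Φ A₀

/-- The empirical quantity `D̃ⁿ_Δ(P̂_y, P)`: the minimum of `D(P̂_x ‖ P)` over the conditional
types of sequences `x` given `y` whose empirical expected distortion is at most `Δ`. -/
def empDtilde {𝒜 : Type*} [Fintype 𝒜] [DecidableEq 𝒜] {n : ℕ} (d : 𝒜 → 𝒜 → ℝ) (Δ : ℝ)
    (y : Fin n → 𝒜) (P : 𝒜 → ℝ) : EReal :=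
  ⨅ x ∈ {x : Fin n → 𝒜 | expDist d (jointType x y) ≤ Δ}, kl (empType x) P

/-- The functional `D̃_Δ(P_Y, P)`: the minimum of `D(P_X ‖ P)` over the joint distributions
`P_XY` with second marginal `P_Y` and expected distortion at most `Δ`. -/
def Dtilde {𝒜 : Type*} [Fintype 𝒜] (d : 𝒜 → 𝒜 → ℝ) (Δ : ℝ) (PY P : 𝒜 → ℝ) : EReal :=
  ⨅ Q ∈ {Q : 𝒜 × 𝒜 → ℝ | Q ∈ stdSimplex ℝ (𝒜 × 𝒜) ∧ margY Q = PY ∧ expDist d Q ≤ Δ},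
    kl (margX Q) P

/-- Heaviside step function, with value `1` at `0`. -/
def heaviside (t : EReal) : ℝ := if 0 ≤ t then 1 else 0

/-- The defence strategy `Φ†(H₁|y) = U(D̃ⁿ_{Δ₀}(P̂_y, P₀) - D̃ⁿ_{Δ₁}(P̂_y, P₁) - a)`. (If both
divergences are infinite, then `y` has probability `0` under both hypotheses when the attack
channels are `A*_{Δ₀}` and `A*_{Δ₁}`, so the value of `⊤ - ⊤` is immaterial.) -/
def defenceDagger {𝒜 : Type*} [Fintype 𝒜] [DecidableEq 𝒜] {n : ℕ} (d : 𝒜 → 𝒜 → ℝ)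
    (Δ₀ Δ₁ a : ℝ) (P₀ P₁ : 𝒜 → ℝ) (y : Fin n → 𝒜) : ℝ :=
  heaviside (empDtilde d Δ₀ y P₀ - empDtilde d Δ₁ y P₁ - (a : EReal))

/-- The Bayes payoff for sequences of length `n` at the profile `(Φ†, (A*_{Δ₀}, A*_{Δ₁}))`. -/
def equilibriumPayoff {𝒜 : Type*} [Fintype 𝒜] [DecidableEq 𝒜] (d : 𝒜 → 𝒜 → ℝ)
    (Δ₀ Δ₁ a : ℝ) (P₀ P₁ : 𝒜 → ℝ) (n : ℕ) : ℝ :=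
  bayesPayoff (n := n) P₀ P₁ a (defenceDagger d Δ₀ Δ₁ a P₀ P₁)
    (attackChannel d Δ₀) (attackChannel d Δ₁)

end

end DetectionGame

/-! The proof is the method of types. Under `P` a sequence has probability `exp (-n D)` times its
probability under its own type, where `D` is the divergence of that type from `P`. A type class has
mass at least 1/poly(n) under its own type, and there are only polynomially many types. The attack
channel costs another polynomial factor, because an admissible conditional type class receives mass
`c_n(x)`, at least 1/poly(n). So only exponents matter.

Upper bound on the payoff (`equilibriumPayoff_le`): where the rule decides `H₀`, the larger of the
two competing quantities is the `H₁` divergence; where it decides `H₁`, it is the `H₀` divergence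
minus `a`. Every source sequence that can cause an error therefore has divergence at least the
min-max value `e`, shifted by `a` for false positives, and the weight `e^{an}` absorbs the shift.

Lower bound (`exp_le_equilibriumPayoff`): take `x₁`, `x₀` admissible for the same `y`. The rule is
constant on the type class of `y`, so this whole class is an error under one hypothesis or the
other, and the larger exponent of the two is always achieved. No property of the rule beyond
symmetry and values in {0, 1} is used here.

The two bounds meet because the min-max is a minimum of a continuous function over a compact set of
pairs of joint laws with equal output marginals (`exists_isMinOn_exponent`). An optimal pair is
glued along `y` into a law of triples and rounded to counts, the remainder going to a letter of
positive probability under both sources (`exists_exponent_lower_bound`). -/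

namespace DetectionGame

/-! ### Memoryless sources, types and the mass of a type class -/

section SourceProb

variable {α : Type*} {n : ℕ}

lemma sourceProb_nonneg {P : α → ℝ} (hP : ∀ a, 0 ≤ P a) (x : Fin n → α) : 0 ≤ sourceProb P x :=
  Finset.prod_nonneg fun _ _ => hP _

lemma sum_sourceProb [Fintype α] {P : α → ℝ} (hP : P ∈ stdSimplex ℝ α) :
    ∑ x : Fin n → α, sourceProb P x = 1 := by
  unfold sourceProb
  rw [← Fintype.sum_pow, hP.2, one_pow]

end SourceProb

section TypeClasses

variable {α : Type*} [DecidableEq α] {n : ℕ}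

lemma count_comp_perm (x : Fin n → α) (σ : Equiv.Perm (Fin n)) (a : α) :
    count (x ∘ σ) a = count x a := by
  unfold count
  exact Finset.card_equiv σ (by simp)

lemma count_le (x : Fin n → α) (a : α) : count x a ≤ n :=
  (Finset.card_filter_le _ _).trans (by simp)

lemma count_apply_pos (x : Fin n → α) (i : Fin n) : 0 < count x (x i) :=
  Finset.card_pos.mpr ⟨i, by simp⟩

lemma sum_count_mul [Fintype α] (x : Fin n → α) (f : α → ℝ) :
    ∑ a, (count x a : ℝ) * f a = ∑ i, f (x i) := by
  simp only [count, Finset.card_filter, Nat.cast_sum, Finset.sum_mul]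
  rw [Finset.sum_comm]
  simp

lemma sum_count [Fintype α] (x : Fin n → α) : ∑ a, count x a = n := by
  have h := sum_count_mul x fun _ => 1
  simp only [mul_one, Finset.sum_const, Finset.card_univ, Fintype.card_fin, nsmul_eq_mul] at h
  exact_mod_cast h

lemma exists_perm_of_count_eq {x y : Fin n → α} (h : ∀ a, count x a = count y a) :
    ∃ σ : Equiv.Perm (Fin n), y = x ∘ σ := by
  let e : ∀ a, {i // y i = a} ≃ {i // x i = a} := fun a =>
    Fintype.equivOfCardEq (by
      rw [Fintype.card_subtype, Fintype.card_subtype]; exact (h a).symm)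
  refine ⟨(Equiv.sigmaFiberEquiv y).symm.trans
    ((Equiv.sigmaCongrRight e).trans (Equiv.sigmaFiberEquiv x)), ?_⟩
  funext i
  exact (e (y i) ⟨i, rfl⟩).2.symm

lemma exists_count_eq [Fintype α] (m : α → ℕ) (hm : ∑ a, m a = n) :
    ∃ x : Fin n → α, ∀ a, count x a = m a := by
  have hc : Fintype.card (Fin n) = Fintype.card ((a : α) × Fin (m a)) := by simp [hm]
  let e := Fintype.equivOfCardEq hc
  refine ⟨fun i => (e i).1, fun a => ?_⟩
  unfold count
  have h : (Finset.univ.filter fun i => (e i).1 = a).card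
      = (Finset.univ.filter fun s : (a : α) × Fin (m a) => s.1 = a).card :=
    Finset.card_equiv e (by simp)
  rw [h, ← Fintype.card_subtype, Fintype.card_congr (Equiv.sigmaSubtype a)]
  simp

lemma empType_nonneg (x : Fin n → α) (a : α) : 0 ≤ empType x a := by
  unfold empType; positivity

lemma empType_mem_stdSimplex [Fintype α] (hn : 0 < n) (x : Fin n → α) :
    empType x ∈ stdSimplex ℝ α := by
  refine ⟨empType_nonneg x, ?_⟩
  have : (n : ℝ) ≠ 0 := by positivity
  simp only [empType]
  rw [← Finset.sum_div, ← Nat.cast_sum, sum_count, div_self this]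

lemma empType_eq_iff (hn : 0 < n) {β : Type*} [DecidableEq β] {x y : Fin n → β} :
    empType x = empType y ↔ ∀ a, count x a = count y a := by
  have : (n : ℝ) ≠ 0 := by positivity
  simp [funext_iff, empType, div_left_inj' this]

/-- The sequences with the type of `x`. -/
def typeClass [Fintype α] (x : Fin n → α) : Finset (Fin n → α) :=
  Finset.univ.filter fun x' => ∀ a, count x' a = count x a

lemma mem_typeClass [Fintype α] {x x' : Fin n → α} :
    x' ∈ typeClass x ↔ ∀ a, count x' a = count x a := by simp [typeClass]

/-- A nonempty fibre of `σ ↦ x ∘ σ` is a coset of the stabilizer of `x`, a product of symmetric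
groups. -/
lemma card_fiber_perm_le [Fintype α] (x x' : Fin n → α) :
    (Finset.univ.filter fun σ : Equiv.Perm (Fin n) => x ∘ σ = x').card
      ≤ ∏ a, (count x a).factorial := by
  by_cases h : ∃ τ : Equiv.Perm (Fin n), x ∘ τ = x'
  · obtain ⟨τ, rfl⟩ := h
    have hs := DomMulAct.stabilizer_card x
    simp only [Fintype.card_subtype] at hs
    change _ = ∏ a, (count x a).factorial at hs
    rw [← hs]
    refine Finset.card_le_card_of_injOn (fun σ => σ * τ⁻¹) ?_
      (fun a _ b _ hab => mul_right_cancel hab)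
    intro σ hσ
    simp only [Finset.coe_filter, Finset.mem_univ, true_and, Set.mem_ofPred_eq] at hσ ⊢
    funext i
    have := congrFun hσ (τ⁻¹ i)
    simpa using this
  · rw [Finset.filter_false_of_mem fun σ _ hσ => h ⟨σ, hσ⟩]
    simp

lemma factorial_le_card_typeClass_mul [Fintype α] (x : Fin n → α) :
    n.factorial ≤ (typeClass x).card * ∏ a, (count x a).factorial := by
  have h := Finset.card_le_mul_card_image (f := fun σ : Equiv.Perm (Fin n) => x ∘ σ)
    Finset.univ (∏ a, (count x a).factorial) fun x' _ => card_fiber_perm_le x x'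
  rw [Finset.card_univ, Fintype.card_perm, Fintype.card_fin, mul_comm] at h
  refine h.trans (Nat.mul_le_mul_right _ (Finset.card_le_card ?_))
  intro x' hx'
  obtain ⟨σ, -, rfl⟩ := Finset.mem_image.mp hx'
  exact mem_typeClass.mpr (count_comp_perm x σ)

/-- The Stirling sequence decreases from its value `e/√2` at 1, which gives the factor `e√k` for `k
≥ 1`. Weakening `√k` to `k + 1` also covers `k = 0`. -/
lemma factorial_le_stirling (k : ℕ) :
    (k.factorial : ℝ) ≤ Real.exp 1 * (k + 1) * (k / Real.exp 1) ^ k := by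
  rcases k with _ | k
  · simp
  · have h := Stirling.stirlingSeq'_antitone (Nat.zero_le k)
    simp only [Function.comp_apply, Nat.succ_eq_add_one, zero_add, Stirling.stirlingSeq_one] at h
    unfold Stirling.stirlingSeq at h
    have h2 : (0 : ℝ) < √2 := by positivity
    have hp : 0 < ((k + 1 : ℕ) / Real.exp 1 : ℝ) ^ (k + 1) := by positivity
    rw [div_le_iff₀ (by positivity)] at h
    refine h.trans ?_
    rw [← mul_assoc]
    refine mul_le_mul_of_nonneg_right ?_ hp.le
    rw [Real.sqrt_mul (by norm_num), ← mul_assoc, div_mul_cancel₀ _ h2.ne']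
    refine mul_le_mul_of_nonneg_left ?_ (Real.exp_pos 1).le
    rw [Real.sqrt_le_left (by positivity)]
    nlinarith [Nat.cast_nonneg (α := ℝ) (k + 1)]

lemma pow_le_factorial (n : ℕ) : ((n : ℝ) / Real.exp 1) ^ n ≤ n.factorial := by
  have h := Real.pow_div_factorial_le_exp (n : ℝ) (Nat.cast_nonneg n) n
  rw [div_le_iff₀ (by positivity)] at h
  rw [div_pow, div_le_iff₀ (by positivity), ← Real.exp_nat_mul, mul_one, mul_comm]
  exact h

/-- Polynomial factor in the method of types. -/
noncomputable def polyFactor (k n : ℕ) : ℝ := (Real.exp 1 * (n + 1)) ^ k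

lemma polyFactor_pos (k n : ℕ) : 0 < polyFactor k n := by unfold polyFactor; positivity

lemma sourceProb_eq_prod_pow [Fintype α] (P : α → ℝ) (x : Fin n → α) :
    sourceProb P x = ∏ a, P a ^ count x a := by
  unfold sourceProb count
  rw [← Finset.prod_fiberwise (g := x)]
  refine Finset.prod_congr rfl fun a _ => ?_
  rw [Finset.prod_congr rfl (g := fun _ => P a), Finset.prod_const]
  intro i hi
  rw [(Finset.mem_filter.mp hi).2]

/-- The class has at least the multinomial number of elements; bounding each factorial by `(k/e)^k`
up to a polynomial turns this into the inverse of the common probability. -/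
lemma one_le_typeClass_mass [Fintype α] (hn : 0 < n) (x : Fin n → α) :
    1 ≤ polyFactor (Fintype.card α) n * ((typeClass x).card * sourceProb (empType x) x) := by
  have hn' : (0 : ℝ) < n := by positivity
  set E := Real.exp 1 with hE
  have hEpos : 0 < E := Real.exp_pos 1
  have h1 : ((n : ℝ) / E) ^ n ≤ (typeClass x).card * ∏ a, ((count x a).factorial : ℝ) :=
    (pow_le_factorial n).trans (by exact_mod_cast factorial_le_card_typeClass_mul x)
  have h2 : ∏ a, ((count x a).factorial : ℝ)
      ≤ polyFactor (Fintype.card α) n * ∏ a, ((count x a : ℝ) / E) ^ count x a := by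
    rw [polyFactor, ← hE, ← Finset.card_univ, ← Finset.prod_const, ← Finset.prod_mul_distrib]
    refine Finset.prod_le_prod (fun _ _ => by positivity) fun a _ => ?_
    refine (factorial_le_stirling _).trans ?_
    have : (count x a : ℝ) ≤ n := by exact_mod_cast count_le x a
    gcongr
  have h3 : ∏ a, ((count x a : ℝ) / E) ^ count x a
      = (n / E) ^ n * sourceProb (empType x) x := by
    rw [sourceProb_eq_prod_pow]
    have : ((n : ℝ) / E) ^ n = ∏ a, ((n : ℝ) / E) ^ count x a := by
      rw [Finset.prod_pow_eq_pow_sum, sum_count]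
    rw [this, ← Finset.prod_mul_distrib]
    refine Finset.prod_congr rfl fun a _ => ?_
    rw [← mul_pow, empType]
    congr 1
    field_simp
  have hp : 0 < ((n : ℝ) / E) ^ n := by positivity
  refine le_of_mul_le_mul_left ?_ hp
  rw [mul_one]
  calc ((n : ℝ) / E) ^ n ≤ (typeClass x).card * ∏ a, ((count x a).factorial : ℝ) := h1
    _ ≤ (typeClass x).card * (polyFactor (Fintype.card α) n *
          ((n / E) ^ n * sourceProb (empType x) x)) := by
        rw [← h3]; gcongr
    _ = _ := by ring

lemma empType_eq_zero_of_support {P : α → ℝ} {x : Fin n → α} (h : ∀ i, P (x i) ≠ 0) (a : α)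
    (ha : P a = 0) : empType x a = 0 := by
  have : count x a = 0 := by
    rw [count, Finset.card_eq_zero, Finset.filter_eq_empty_iff]
    rintro i - rfl
    exact h i ha
  simp [empType, this]

end TypeClasses

/-! ### Divergence and the probability of type classes -/

section Divergence

variable {α : Type*} [Fintype α]

/-- The real number given by the Kullback--Leibler sum, without the support condition. -/
noncomputable def klSum (P Q : α → ℝ) : ℝ := ∑ a, P a * Real.log (P a / Q a)

lemma kl_eq_klSum {P Q : α → ℝ} (h : ∀ a, Q a = 0 → P a = 0) : kl P Q = (klSum P Q : EReal) := by
  rw [kl, if_pos h, klSum]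

/-- Continuity holds even where the divergence is infinite: a term with `Q a = 0` is identically 0,
by division by zero and `log 0 = 0`. The support condition is imposed separately. -/
lemma continuous_klSum (Q : α → ℝ) : Continuous fun P : α → ℝ => klSum P Q := by
  unfold klSum
  refine continuous_finsetSum _ fun a _ => ?_
  by_cases hQ : Q a = 0
  · simp only [hQ, div_zero, Real.log_zero, mul_zero]; exact continuous_const
  · have h : (fun P : α → ℝ => P a * Real.log (P a / Q a))
        = fun P => Q a * ((P a / Q a) * Real.log (P a / Q a)) := by
      funext P; field_simp
    rw [h]
    exact continuous_const.mul (Real.continuous_mul_log.comp ((continuous_apply a).div_const _))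

variable [DecidableEq α] {n : ℕ}

lemma sourceProb_eq_exp {P : α → ℝ} (hP : ∀ a, 0 ≤ P a) {x : Fin n → α} (h : ∀ i, P (x i) ≠ 0) :
    sourceProb P x = Real.exp (-(n * klSum (empType x) P)) * sourceProb (empType x) x := by
  rcases Nat.eq_zero_or_pos n with rfl | hn
  · simp [sourceProb]
  have hn' : (0 : ℝ) < n := by positivity
  have hk : n * klSum (empType x) P = ∑ i, Real.log (empType x (x i) / P (x i)) := by
    rw [← sum_count_mul x fun a => Real.log (empType x a / P a), klSum, Finset.mul_sum]
    refine Finset.sum_congr rfl fun a _ => ?_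
    rw [← mul_assoc]
    congr 1
    rw [empType]; field_simp
  rw [hk, Real.exp_neg, Real.exp_sum]
  unfold sourceProb
  rw [← Finset.prod_inv_distrib, ← Finset.prod_mul_distrib]
  refine Finset.prod_congr rfl fun i _ => ?_
  have h1 : 0 < P (x i) := lt_of_le_of_ne (hP _) (h i).symm
  have h2 : 0 < empType x (x i) := by
    unfold empType
    have := count_apply_pos x i
    positivity
  rw [Real.exp_log (by positivity)]
  field_simp

lemma card_image_empType_le (n : ℕ) :
    (Finset.univ.image fun x : Fin n → α => empType x).card ≤ (n + 1) ^ Fintype.card α := by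
  have h : (Finset.univ.image fun x : Fin n → α => empType x)
      ⊆ Finset.univ.image fun m : α → Fin (n + 1) => fun a => ((m a : ℕ) : ℝ) / n := by
    intro q hq
    obtain ⟨x, -, rfl⟩ := Finset.mem_image.mp hq
    refine Finset.mem_image.mpr ⟨fun a => ⟨count x a, Nat.lt_succ_of_le (count_le x a)⟩,
      Finset.mem_univ _, rfl⟩
  refine (Finset.card_le_card h).trans (Finset.card_image_le.trans ?_)
  simp

lemma succ_pow_le_polyFactor (k n : ℕ) : ((n : ℝ) + 1) ^ k ≤ polyFactor k n := by
  unfold polyFactor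
  have : 1 ≤ Real.exp 1 := Real.one_le_exp (by norm_num)
  gcongr
  nlinarith [Nat.cast_nonneg (α := ℝ) n]

/-- Each summand is bounded by the sum over all types `q` of the probability of `x` under `q`; every
`q` has total mass 1, so the number of types is a bound. -/
lemma sum_sourceProb_empType_le (hn : 0 < n) :
    ∑ x : Fin n → α, sourceProb (empType x) x ≤ polyFactor (Fintype.card α) n := by
  calc ∑ x : Fin n → α, sourceProb (empType x) x
      ≤ ∑ x : Fin n → α, ∑ q ∈ Finset.univ.image (fun x : Fin n → α => empType x),
          sourceProb q x := by
        refine Finset.sum_le_sum fun x _ => ?_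
        refine Finset.single_le_sum (f := fun q => sourceProb q x) (fun q hq => ?_)
          (Finset.mem_image_of_mem _ (Finset.mem_univ x))
        obtain ⟨z, -, rfl⟩ := Finset.mem_image.mp hq
        exact sourceProb_nonneg (empType_nonneg z) x
    _ = (Finset.univ.image fun x : Fin n → α => empType x).card := by
        rw [Finset.sum_comm, Finset.sum_congr rfl (g := fun _ => (1 : ℝ))]
        · simp
        · intro q hq
          obtain ⟨z, -, rfl⟩ := Finset.mem_image.mp hq
          exact sum_sourceProb (empType_mem_stdSimplex hn z)
    _ ≤ ((n : ℝ) + 1) ^ Fintype.card α := by exact_mod_cast card_image_empType_le n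
    _ ≤ _ := succ_pow_le_polyFactor _ _

/-- Sanov's upper bound. -/
lemma sum_sourceProb_le_of_le_klSum (hn : 0 < n) {P : α → ℝ} (hP : ∀ a, 0 ≤ P a) (E : ℝ)
    (S : Finset (Fin n → α))
    (hS : ∀ x ∈ S, (∀ i, P (x i) ≠ 0) → E ≤ klSum (empType x) P) :
    ∑ x ∈ S, sourceProb P x ≤ polyFactor (Fintype.card α) n * Real.exp (-(n * E)) := by
  calc ∑ x ∈ S, sourceProb P x
      ≤ ∑ x ∈ S, sourceProb (empType x) x * Real.exp (-(n * E)) := by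
        refine Finset.sum_le_sum fun x hx => ?_
        have h0 := sourceProb_nonneg (empType_nonneg x) x
        by_cases h : ∀ i, P (x i) ≠ 0
        · rw [sourceProb_eq_exp hP h, mul_comm]
          have := hS x hx h
          gcongr
        · push Not at h
          obtain ⟨i, hi⟩ := h
          rw [sourceProb, Finset.prod_eq_zero (Finset.mem_univ i) hi]
          positivity
    _ ≤ ∑ x : Fin n → α, sourceProb (empType x) x * Real.exp (-(n * E)) :=
        Finset.sum_le_univ_sum_of_nonneg fun x =>
          mul_nonneg (sourceProb_nonneg (empType_nonneg x) x) (Real.exp_pos _).le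
    _ ≤ _ := by
        rw [← Finset.sum_mul]
        exact mul_le_mul_of_nonneg_right (sum_sourceProb_empType_le hn) (Real.exp_pos _).le

lemma sourceProb_congr_typeClass (P : α → ℝ) {x x' : Fin n → α} (h : x' ∈ typeClass x) :
    sourceProb P x' = sourceProb P x := by
  simp only [sourceProb_eq_prod_pow, mem_typeClass.mp h]

lemma exp_le_sum_typeClass (hn : 0 < n) {P : α → ℝ} (hP : ∀ a, 0 ≤ P a) {x : Fin n → α}
    (h : ∀ i, P (x i) ≠ 0) :
    Real.exp (-(n * klSum (empType x) P))
      ≤ polyFactor (Fintype.card α) n * ∑ x' ∈ typeClass x, sourceProb P x' := by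
  rw [Finset.sum_congr rfl fun x' hx' => sourceProb_congr_typeClass P hx', Finset.sum_const,
    nsmul_eq_mul, sourceProb_eq_exp hP h]
  have := mul_le_mul_of_nonneg_left (one_le_typeClass_mass hn x)
    (Real.exp_pos (-(n * klSum (empType x) P))).le
  calc _ = _ := (mul_one _).symm
    _ ≤ _ := this
    _ = _ := by ring

end Divergence

end DetectionGame

namespace DetectionGame

/-! ### The attack channel and its output distribution -/

section SeqDist

variable {𝒜 : Type*} {n : ℕ}

lemma seqDist_comp_perm (d : 𝒜 → 𝒜 → ℝ) (x y : Fin n → 𝒜) (σ : Equiv.Perm (Fin n)) :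
    seqDist d (x ∘ σ) (y ∘ σ) = seqDist d x y :=
  Equiv.sum_comp σ fun i => d (x i) (y i)

lemma exists_perm_of_jointType_eq [DecidableEq 𝒜] (hn : 0 < n) {x y x' y' : Fin n → 𝒜}
    (h : jointType x' y' = jointType x y) :
    ∃ σ : Equiv.Perm (Fin n), x' = x ∘ σ ∧ y' = y ∘ σ := by
  obtain ⟨σ, hσ⟩ := exists_perm_of_count_eq fun p => ((empType_eq_iff hn).mp h p).symm
  exact ⟨σ, funext fun i => congrArg Prod.fst (congrFun hσ i),
    funext fun i => congrArg Prod.snd (congrFun hσ i)⟩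

end SeqDist

section AttackChannel

variable {𝒜 : Type*} [Fintype 𝒜] [DecidableEq 𝒜] {n : ℕ}

lemma sum_jointType_mul (x y : Fin n → 𝒜) (f : 𝒜 × 𝒜 → ℝ) :
    ∑ p, jointType x y p * f p = (∑ i, f (x i, y i)) / n := by
  rw [← sum_count_mul (fun i => (x i, y i)) f, Finset.sum_div]
  refine Finset.sum_congr rfl fun p _ => ?_
  rw [jointType, empType]; ring

lemma expDist_jointType (d : 𝒜 → 𝒜 → ℝ) (x y : Fin n → 𝒜) :
    expDist d (jointType x y) = seqDist d x y / n :=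
  sum_jointType_mul x y fun p => d p.1 p.2

lemma expDist_jointType_le_iff (hn : 0 < n) (d : 𝒜 → 𝒜 → ℝ) (Δ : ℝ) (x y : Fin n → 𝒜) :
    expDist d (jointType x y) ≤ Δ ↔ seqDist d x y ≤ n * Δ := by
  rw [expDist_jointType, div_le_iff₀' (by positivity)]

lemma mem_condTypeClass {x y y' : Fin n → 𝒜} :
    y' ∈ condTypeClass x y ↔ jointType x y' = jointType x y := by simp [condTypeClass]

lemma condTypeClass_eq_of_mem {x y y' : Fin n → 𝒜} (h : y' ∈ condTypeClass x y) :
    condTypeClass x y' = condTypeClass x y := by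
  ext z; rw [mem_condTypeClass, mem_condTypeClass, mem_condTypeClass.mp h]

lemma recipNumClasses_nonneg (d : 𝒜 → 𝒜 → ℝ) (Δ : ℝ) (x : Fin n → 𝒜) :
    0 ≤ recipNumClasses d Δ x := by unfold recipNumClasses; positivity

lemma attackChannel_nonneg (d : 𝒜 → 𝒜 → ℝ) (Δ : ℝ) (x y : Fin n → 𝒜) :
    0 ≤ attackChannel d Δ x y := by
  unfold attackChannel
  have := recipNumClasses_nonneg d Δ x
  split_ifs <;> positivity

lemma sum_attackChannel_le_one (d : 𝒜 → 𝒜 → ℝ) (Δ : ℝ) (x : Fin n → 𝒜) :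
    ∑ y, attackChannel d Δ x y ≤ 1 := by
  set F := Finset.univ.filter fun y : Fin n → 𝒜 => seqDist d x y ≤ n * Δ with hF
  have h1 : ∑ y, attackChannel d Δ x y
      = ∑ C ∈ F.image (condTypeClass x), ∑ y ∈ F with condTypeClass x y = C,
          recipNumClasses d Δ x / (C.card : ℝ) := by
    unfold attackChannel
    rw [← Finset.sum_filter, ← hF,
      ← Finset.sum_fiberwise_of_maps_to fun y hy => Finset.mem_image_of_mem (condTypeClass x) hy]
    refine Finset.sum_congr rfl fun C _ => Finset.sum_congr rfl fun y hy => ?_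
    rw [(Finset.mem_filter.mp hy).2]
  have h2 : ∀ C ∈ F.image (condTypeClass x), ∑ y ∈ F with condTypeClass x y = C,
      recipNumClasses d Δ x / (C.card : ℝ) ≤ recipNumClasses d Δ x := by
    intro C _
    -- A sequence lies in its own class, so at most `C.card` terms equal to `c_n / C.card` occur.
    -- Only this inequality is needed.
    have hsub : (F.filter fun y => condTypeClass x y = C) ⊆ C := by
      intro y hy
      rw [← (Finset.mem_filter.mp hy).2, mem_condTypeClass]
    have hc : ((F.filter fun y => condTypeClass x y = C).card : ℝ) ≤ C.card := by
      exact_mod_cast Finset.card_le_card hsub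
    rw [Finset.sum_const, nsmul_eq_mul, mul_div_left_comm]
    exact mul_le_of_le_one_right (recipNumClasses_nonneg d Δ x)
      (div_le_one_of_le₀ hc (by positivity))
  rw [h1]
  refine (Finset.sum_le_sum h2).trans ?_
  rw [Finset.sum_const, nsmul_eq_mul]
  exact mul_inv_le_one

lemma one_le_polyFactor_mul_recipNumClasses {d : 𝒜 → 𝒜 → ℝ} {Δ : ℝ} {x y : Fin n → 𝒜}
    (h : seqDist d x y ≤ n * Δ) :
    1 ≤ polyFactor (Fintype.card (𝒜 × 𝒜)) n * recipNumClasses d Δ x := by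
  set I := (Finset.univ.filter fun y : Fin n → 𝒜 => seqDist d x y ≤ n * Δ).image
    (condTypeClass x) with hI
  have hpos : 0 < I.card :=
    Finset.card_pos.mpr ⟨_, Finset.mem_image_of_mem _ (Finset.mem_filter.mpr ⟨Finset.mem_univ y, h⟩)⟩
  have hle : I.card ≤ (n + 1) ^ Fintype.card (𝒜 × 𝒜) := by
    have hsub : I ⊆ (Finset.univ.image fun z : Fin n → 𝒜 × 𝒜 => empType z).image
        fun q => Finset.univ.filter fun y' => jointType x y' = q := by
      intro C hC
      obtain ⟨y, -, rfl⟩ := Finset.mem_image.mp hC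
      exact Finset.mem_image.mpr ⟨jointType x y, Finset.mem_image_of_mem _ (Finset.mem_univ _), rfl⟩
    exact (Finset.card_le_card hsub).trans (Finset.card_image_le.trans (card_image_empType_le n))
  have hle' : (I.card : ℝ) ≤ polyFactor (Fintype.card (𝒜 × 𝒜)) n :=
    le_trans (by exact_mod_cast hle) (succ_pow_le_polyFactor _ _)
  rw [recipNumClasses, ← hI, ← div_eq_mul_inv, one_le_div (by exact_mod_cast hpos)]
  exact hle'

lemma sum_condTypeClass_attackChannel (hn : 0 < n) {d : 𝒜 → 𝒜 → ℝ} {Δ : ℝ} {x y : Fin n → 𝒜}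
    (h : seqDist d x y ≤ n * Δ) :
    ∑ y' ∈ condTypeClass x y, attackChannel d Δ x y' = recipNumClasses d Δ x := by
  have hc : 0 < (condTypeClass x y).card := Finset.card_pos.mpr ⟨y, mem_condTypeClass.mpr rfl⟩
  have h1 : ∀ y' ∈ condTypeClass x y, attackChannel d Δ x y'
      = recipNumClasses d Δ x / (condTypeClass x y).card := by
    intro y' hy'
    rw [attackChannel, condTypeClass_eq_of_mem hy', if_pos]
    rwa [← expDist_jointType_le_iff hn, mem_condTypeClass.mp hy', expDist_jointType_le_iff hn]
  rw [Finset.sum_congr rfl h1, Finset.sum_const, nsmul_eq_mul]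
  field_simp

lemma outputProb_nonneg {P : 𝒜 → ℝ} (hP : ∀ a, 0 ≤ P a) (d : 𝒜 → 𝒜 → ℝ) (Δ : ℝ)
    (y : Fin n → 𝒜) : 0 ≤ outputProb P (attackChannel d Δ) y :=
  Finset.sum_nonneg fun x _ => mul_nonneg (sourceProb_nonneg hP x) (attackChannel_nonneg d Δ x y)

/-- The channel has total mass at most 1, so the output mass of `S` is at most the source mass of
the inputs that can reach `S`; Sanov's bound applies to these. -/
lemma sum_outputProb_le (hn : 0 < n) {P : 𝒜 → ℝ} (hP : ∀ a, 0 ≤ P a) (d : 𝒜 → 𝒜 → ℝ) (Δ E : ℝ)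
    (S : Finset (Fin n → 𝒜))
    (hS : ∀ y ∈ S, ∀ x, seqDist d x y ≤ n * Δ → (∀ i, P (x i) ≠ 0) → E ≤ klSum (empType x) P) :
    ∑ y ∈ S, outputProb P (attackChannel d Δ) y
      ≤ polyFactor (Fintype.card 𝒜) n * Real.exp (-(n * E)) := by
  set X := Finset.univ.filter fun x : Fin n → 𝒜 => ∃ y ∈ S, seqDist d x y ≤ n * Δ with hX
  unfold outputProb
  rw [Finset.sum_comm]
  calc ∑ x, ∑ y ∈ S, sourceProb P x * attackChannel d Δ x y
      ≤ ∑ x, if ∃ y ∈ S, seqDist d x y ≤ n * Δ then sourceProb P x else 0 := by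
        refine Finset.sum_le_sum fun x _ => ?_
        rw [← Finset.mul_sum]
        split_ifs with h
        · refine mul_le_of_le_one_right (sourceProb_nonneg hP x) (le_trans ?_
            (sum_attackChannel_le_one d Δ x))
          exact Finset.sum_le_univ_sum_of_nonneg fun y => attackChannel_nonneg d Δ x y
        · push Not at h
          rw [Finset.sum_eq_zero, mul_zero]
          intro y hy
          rw [attackChannel, if_neg (not_le.mpr (h y hy))]
    _ = ∑ x ∈ X, sourceProb P x := by rw [← Finset.sum_filter]
    _ ≤ _ := by
        refine sum_sourceProb_le_of_le_klSum hn hP E X fun x hx hx' => ?_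
        obtain ⟨y, hy, hxy⟩ := (Finset.mem_filter.mp hx).2
        exact hS y hy x hxy hx'

/-- Any `x ∘ σ` in the type class of `x` can be sent to `y ∘ σ` at the same distortion. The
conditional class of that pair lies in the type class of `y` and receives mass `c_n`. -/
lemma exp_le_sum_outputProb (hn : 0 < n) {P : 𝒜 → ℝ} (hP : ∀ a, 0 ≤ P a) {d : 𝒜 → 𝒜 → ℝ} {Δ : ℝ}
    {x y : Fin n → 𝒜} (h : seqDist d x y ≤ n * Δ) (hx : ∀ i, P (x i) ≠ 0) :
    Real.exp (-(n * klSum (empType x) P))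
      ≤ polyFactor (Fintype.card 𝒜) n * (polyFactor (Fintype.card (𝒜 × 𝒜)) n *
          ∑ y' ∈ typeClass y, outputProb P (attackChannel d Δ) y') := by
  refine (exp_le_sum_typeClass hn hP hx).trans ?_
  refine mul_le_mul_of_nonneg_left ?_ (polyFactor_pos _ _).le
  unfold outputProb
  rw [Finset.sum_comm, Finset.mul_sum]
  refine (Finset.sum_le_sum (g := fun x' => polyFactor (Fintype.card (𝒜 × 𝒜)) n *
    ∑ y' ∈ typeClass y, sourceProb P x' * attackChannel d Δ x' y') fun x' hx' => ?_).trans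
    (Finset.sum_le_univ_sum_of_nonneg fun x' => mul_nonneg (polyFactor_pos _ _).le
      (Finset.sum_nonneg fun y' _ =>
        mul_nonneg (sourceProb_nonneg hP x') (attackChannel_nonneg d Δ x' y')))
  obtain ⟨σ, rfl⟩ := exists_perm_of_count_eq fun a => (mem_typeClass.mp hx' a).symm
  have hσ : seqDist d (x ∘ σ) (y ∘ σ) ≤ n * Δ := by rwa [seqDist_comp_perm]
  have hsub : condTypeClass (x ∘ σ) (y ∘ σ) ⊆ typeClass y := by
    intro y' hy'
    obtain ⟨τ, -, rfl⟩ := exists_perm_of_jointType_eq hn (mem_condTypeClass.mp hy')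
    exact mem_typeClass.mpr fun a => by rw [count_comp_perm, count_comp_perm]
  have h1 := one_le_polyFactor_mul_recipNumClasses hσ
  rw [← sum_condTypeClass_attackChannel hn hσ] at h1
  rw [← Finset.mul_sum, mul_left_comm]
  refine le_mul_of_one_le_right (sourceProb_nonneg hP _) (h1.trans ?_)
  exact mul_le_mul_of_nonneg_left (Finset.sum_le_sum_of_subset_of_nonneg hsub
    fun y' _ _ => attackChannel_nonneg d Δ _ y') (polyFactor_pos _ _).le

lemma empDtilde_comp_perm (d : 𝒜 → 𝒜 → ℝ) (Δ : ℝ) (y : Fin n → 𝒜) (P : 𝒜 → ℝ)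
    (σ : Equiv.Perm (Fin n)) : empDtilde d Δ (y ∘ σ) P = empDtilde d Δ y P := by
  unfold empDtilde
  refine (Equiv.iInf_congr (Equiv.arrowCongr σ.symm (Equiv.refl 𝒜)) fun x => ?_).symm
  have h1 : (Equiv.arrowCongr σ.symm (Equiv.refl 𝒜)) x = x ∘ σ := by
    funext i; simp
  have h2 : empType (x ∘ σ) = empType x := by
    funext a; rw [empType, empType, count_comp_perm]
  have h3 : jointType (x ∘ σ) (y ∘ σ) = jointType x y := by
    funext p
    exact congrArg (fun k : ℕ => (k : ℝ) / n) (count_comp_perm (fun i => (x i, y i)) σ p)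
  rw [h1, h2]
  simp only [Set.mem_ofPred_eq, h3]

end AttackChannel

/-! ### Bounds on the Bayes payoff -/

section Payoff

variable {𝒜 : Type*} [Fintype 𝒜] [DecidableEq 𝒜] {n : ℕ}

lemma heaviside_eq_zero_or_one (t : EReal) : heaviside t = 0 ∨ heaviside t = 1 := by
  unfold heaviside; split_ifs <;> simp

lemma defenceDagger_congr_typeClass (d : 𝒜 → 𝒜 → ℝ) (Δ₀ Δ₁ a : ℝ) (P₀ P₁ : 𝒜 → ℝ)
    {y y' : Fin n → 𝒜} (h : y' ∈ typeClass y) :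
    defenceDagger d Δ₀ Δ₁ a P₀ P₁ y' = defenceDagger d Δ₀ Δ₁ a P₀ P₁ y := by
  obtain ⟨σ, rfl⟩ := exists_perm_of_count_eq fun b => (mem_typeClass.mp h b).symm
  simp only [defenceDagger, empDtilde_comp_perm]

lemma exp_le_equilibriumPayoff (hn : 0 < n) {d : 𝒜 → 𝒜 → ℝ} {Δ₀ Δ₁ a : ℝ} {P₀ P₁ : 𝒜 → ℝ}
    (hP₀ : ∀ b, 0 ≤ P₀ b) (hP₁ : ∀ b, 0 ≤ P₁ b) {x₀ x₁ y : Fin n → 𝒜}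
    (h₀ : seqDist d x₀ y ≤ n * Δ₀) (h₁ : seqDist d x₁ y ≤ n * Δ₁)
    (hs₀ : ∀ i, P₀ (x₀ i) ≠ 0) (hs₁ : ∀ i, P₁ (x₁ i) ≠ 0) :
    Real.exp (-(n * max (klSum (empType x₁) P₁) (klSum (empType x₀) P₀ - a)))
      ≤ polyFactor (Fintype.card 𝒜) n * polyFactor (Fintype.card (𝒜 × 𝒜)) n *
          equilibriumPayoff d Δ₀ Δ₁ a P₀ P₁ n := by
  set Φ := defenceDagger (n := n) d Δ₀ Δ₁ a P₀ P₁ with hΦ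
  have hΦ01 : ∀ z, Φ z = 0 ∨ Φ z = 1 := fun z => heaviside_eq_zero_or_one _
  have hFN : ∀ z, 0 ≤ outputProb P₁ (attackChannel d Δ₁) z * (1 - Φ z) := fun z =>
    mul_nonneg (outputProb_nonneg hP₁ d Δ₁ z) (by rcases hΦ01 z with h | h <;> simp [h])
  have hFP : ∀ z, 0 ≤ outputProb P₀ (attackChannel d Δ₀) z * Φ z := fun z =>
    mul_nonneg (outputProb_nonneg hP₀ d Δ₀ z) (by rcases hΦ01 z with h | h <;> simp [h])
  have hC := mul_pos (polyFactor_pos (Fintype.card 𝒜) n) (polyFactor_pos (Fintype.card (𝒜 × 𝒜)) n)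
  have hn' : (0 : ℝ) ≤ n := by positivity
  unfold equilibriumPayoff bayesPayoff
  rw [← hΦ]
  have hFN' : 0 ≤ probFN P₁ Φ (attackChannel d Δ₁) := Finset.sum_nonneg fun z _ => hFN z
  have hFP' : 0 ≤ probFP P₀ Φ (attackChannel d Δ₀) := Finset.sum_nonneg fun z _ => hFP z
  rcases hΦ01 y with h | h
  · have key := exp_le_sum_outputProb hn hP₁ h₁ hs₁
    have hle : ∑ y' ∈ typeClass y, outputProb P₁ (attackChannel d Δ₁) y'
        ≤ probFN P₁ Φ (attackChannel d Δ₁) := by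
      rw [Finset.sum_congr rfl (g := fun y' => outputProb P₁ (attackChannel d Δ₁) y' * (1 - Φ y'))]
      · exact Finset.sum_le_univ_sum_of_nonneg hFN
      · intro y' hy'
        rw [hΦ, defenceDagger_congr_typeClass d Δ₀ Δ₁ a P₀ P₁ hy', ← hΦ, h, sub_zero, mul_one]
    calc _ ≤ Real.exp (-(n * klSum (empType x₁) P₁)) := by
          gcongr; exact le_max_left _ _
      _ ≤ _ := key
      _ = _ := (mul_assoc _ _ _).symm
      _ ≤ _ := mul_le_mul_of_nonneg_left (hle.trans
          (le_add_of_nonneg_right (mul_nonneg (Real.exp_pos _).le hFP'))) hC.le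
  · have key := exp_le_sum_outputProb hn hP₀ h₀ hs₀
    have hle : ∑ y' ∈ typeClass y, outputProb P₀ (attackChannel d Δ₀) y'
        ≤ probFP P₀ Φ (attackChannel d Δ₀) := by
      rw [Finset.sum_congr rfl (g := fun y' => outputProb P₀ (attackChannel d Δ₀) y' * Φ y')]
      · exact Finset.sum_le_univ_sum_of_nonneg hFP
      · intro y' hy'
        rw [hΦ, defenceDagger_congr_typeClass d Δ₀ Δ₁ a P₀ P₁ hy', ← hΦ, h, mul_one]
    calc _ ≤ Real.exp (-(n * (klSum (empType x₀) P₀ - a))) := by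
          gcongr; exact le_max_right _ _
      _ = Real.exp (a * n) * Real.exp (-(n * klSum (empType x₀) P₀)) := by
          rw [← Real.exp_add]; congr 1; ring
      _ ≤ Real.exp (a * n) * _ := mul_le_mul_of_nonneg_left key (Real.exp_pos _).le
      _ = polyFactor (Fintype.card 𝒜) n * polyFactor (Fintype.card (𝒜 × 𝒜)) n *
          (Real.exp (a * n) *
            ∑ y' ∈ typeClass y, outputProb P₀ (attackChannel d Δ₀) y') := by ring
      _ ≤ _ := mul_le_mul_of_nonneg_left ((mul_le_mul_of_nonneg_left hle (Real.exp_pos _).le).trans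
          (le_add_of_nonneg_left hFN')) hC.le

lemma margX_jointType (x y : Fin n → 𝒜) : margX (jointType x y) = empType x := by
  funext b
  have h := sum_jointType_mul x y fun p => if p.1 = b then 1 else 0
  rw [← sum_count_mul x fun c => if c = b then 1 else 0] at h
  simp only [Fintype.sum_prod_type, mul_ite, mul_one, mul_zero] at h
  rw [Finset.sum_comm] at h
  simpa [margX, empType] using h

lemma margY_jointType (x y : Fin n → 𝒜) : margY (jointType x y) = empType y := by
  funext b
  have h := sum_jointType_mul x y fun p => if p.2 = b then 1 else 0
  rw [← sum_count_mul y fun c => if c = b then 1 else 0] at h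
  simp only [Fintype.sum_prod_type, mul_ite, mul_one, mul_zero] at h
  simpa [margY, empType] using h

lemma Dtilde_le_empDtilde (hn : 0 < n) (d : 𝒜 → 𝒜 → ℝ) (Δ : ℝ) (y : Fin n → 𝒜) (P : 𝒜 → ℝ) :
    Dtilde d Δ (empType y) P ≤ empDtilde d Δ y P := by
  unfold Dtilde empDtilde
  refine le_iInf₂ fun x hx => ?_
  rw [← margX_jointType x y]
  exact iInf₂_le (jointType x y) ⟨empType_mem_stdSimplex hn _, margY_jointType x y, hx⟩

/-- The indeterminate case falls here: `⊤ - ⊤ = ⊥` in `EReal`, so the rule decides `H₀`, and the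
conclusion is still true. -/
lemma sub_le_of_not_nonneg {s t : EReal} {a : ℝ} (h : ¬ 0 ≤ s - t - (a : EReal)) :
    s - (a : EReal) ≤ t := by
  induction s <;> induction t <;> try simp at h ⊢
  norm_cast at h ⊢; linarith

lemma le_sub_of_nonneg {s t : EReal} {a : ℝ} (h : 0 ≤ s - t - (a : EReal)) :
    t ≤ s - (a : EReal) := by
  induction s <;> induction t <;> try simp at h ⊢
  norm_cast at h ⊢; linarith

lemma equilibriumPayoff_le (hn : 0 < n) {d : 𝒜 → 𝒜 → ℝ} {Δ₀ Δ₁ a : ℝ} {P₀ P₁ : 𝒜 → ℝ}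
    (hP₀ : ∀ b, 0 ≤ P₀ b) (hP₁ : ∀ b, 0 ≤ P₁ b) {e : ℝ}
    (he : ∀ PY ∈ stdSimplex ℝ 𝒜,
      (e : EReal) ≤ max (Dtilde d Δ₁ PY P₁) (Dtilde d Δ₀ PY P₀ - (a : EReal))) :
    equilibriumPayoff d Δ₀ Δ₁ a P₀ P₁ n
      ≤ 2 * polyFactor (Fintype.card 𝒜) n * Real.exp (-(n * e)) := by
  set Φ := defenceDagger (n := n) d Δ₀ Δ₁ a P₀ P₁ with hΦ
  have he' : ∀ y : Fin n → 𝒜, (e : EReal) ≤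
      max (empDtilde d Δ₁ y P₁) (empDtilde d Δ₀ y P₀ - (a : EReal)) := fun y =>
    (he _ (empType_mem_stdSimplex hn y)).trans (max_le_max (Dtilde_le_empDtilde hn d Δ₁ y P₁)
      (EReal.sub_le_sub (Dtilde_le_empDtilde hn d Δ₀ y P₀) le_rfl))
  have hkl : ∀ (Δ : ℝ) (P : 𝒜 → ℝ) (x y : Fin n → 𝒜), seqDist d x y ≤ n * Δ →
      (∀ i, P (x i) ≠ 0) → empDtilde d Δ y P ≤ (klSum (empType x) P : EReal) := by
    intro Δ P x y hxy hx
    rw [← kl_eq_klSum (empType_eq_zero_of_support hx)]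
    exact iInf₂_le x ((expDist_jointType_le_iff hn d Δ x y).mpr hxy)
  have hFN : probFN P₁ Φ (attackChannel d Δ₁)
      ≤ polyFactor (Fintype.card 𝒜) n * Real.exp (-(n * e)) := by
    have h1 : probFN P₁ Φ (attackChannel d Δ₁)
        = ∑ y with Φ y = 0, outputProb P₁ (attackChannel d Δ₁) y := by
      rw [Finset.sum_filter]
      refine Finset.sum_congr rfl fun y _ => ?_
      rcases heaviside_eq_zero_or_one (empDtilde d Δ₀ y P₀ - empDtilde d Δ₁ y P₁ - (a : EReal))
        with h | h <;> change Φ y = _ at h <;> simp [h]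
    rw [h1]
    refine sum_outputProb_le hn hP₁ d Δ₁ e _ fun y hy x hxy hx => ?_
    have h0 : Φ y = 0 := (Finset.mem_filter.mp hy).2
    simp only [hΦ, defenceDagger, heaviside, ite_eq_right_iff, one_ne_zero, imp_false] at h0
    have h2 := he' y
    rw [max_eq_left (sub_le_of_not_nonneg h0)] at h2
    exact_mod_cast h2.trans (hkl Δ₁ P₁ x y hxy hx)
  have hFP : probFP P₀ Φ (attackChannel d Δ₀)
      ≤ polyFactor (Fintype.card 𝒜) n * Real.exp (-(n * (e + a))) := by
    have h1 : probFP P₀ Φ (attackChannel d Δ₀)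
        = ∑ y with Φ y = 1, outputProb P₀ (attackChannel d Δ₀) y := by
      rw [Finset.sum_filter]
      refine Finset.sum_congr rfl fun y _ => ?_
      rcases heaviside_eq_zero_or_one (empDtilde d Δ₀ y P₀ - empDtilde d Δ₁ y P₁ - (a : EReal))
        with h | h <;> change Φ y = _ at h <;> simp [h]
    rw [h1]
    refine sum_outputProb_le hn hP₀ d Δ₀ (e + a) _ fun y hy x hxy hx => ?_
    have h0 : Φ y = 1 := (Finset.mem_filter.mp hy).2
    simp only [hΦ, defenceDagger, heaviside, ite_eq_left_iff, zero_ne_one, imp_false,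
      not_not] at h0
    have h2 := he' y
    rw [max_eq_right (le_sub_of_nonneg h0)] at h2
    have h3 := h2.trans (EReal.sub_le_sub (hkl Δ₀ P₀ x y hxy hx) le_rfl)
    rw [← EReal.coe_sub, EReal.coe_le_coe_iff] at h3
    linarith
  unfold equilibriumPayoff bayesPayoff
  rw [← hΦ]
  have h4 := mul_le_mul_of_nonneg_left hFP (Real.exp_pos (a * n)).le
  have h5 : Real.exp (a * n) * (polyFactor (Fintype.card 𝒜) n * Real.exp (-(n * (e + a))))
      = polyFactor (Fintype.card 𝒜) n * Real.exp (-(n * e)) := by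
    rw [mul_left_comm, ← Real.exp_add]; congr 2; ring
  linarith

end Payoff

end DetectionGame

namespace DetectionGame

/-! ### Rounding, gluing and feasible joint laws -/

section Rounding

variable {β : Type*} [Fintype β] [DecidableEq β]

/-- Every cell but `r` is rounded down and `r` takes the remainder, so null cells other than `r`
stay empty. -/
lemma exists_rounding {R : β → ℝ} (hR : R ∈ stdSimplex ℝ β) (r : β) (n : ℕ) :
    ∃ z : Fin n → β, ∀ b, b ≠ r → count z b = ⌊R b * n⌋₊ := by
  have hle : ∑ b ∈ Finset.univ.erase r, ⌊R b * n⌋₊ ≤ n := by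
    have h : ((∑ b ∈ Finset.univ.erase r, ⌊R b * n⌋₊ : ℕ) : ℝ) ≤ n := by
      push_cast
      calc ∑ b ∈ Finset.univ.erase r, (⌊R b * n⌋₊ : ℝ)
          ≤ ∑ b ∈ Finset.univ.erase r, R b * n := Finset.sum_le_sum fun b _ =>
            Nat.floor_le (mul_nonneg (hR.1 b) (Nat.cast_nonneg n))
        _ ≤ ∑ b, R b * n := Finset.sum_le_univ_sum_of_nonneg fun b =>
            mul_nonneg (hR.1 b) (Nat.cast_nonneg n)
        _ = n := by rw [← Finset.sum_mul, hR.2, one_mul]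
    exact_mod_cast h
  obtain ⟨z, hz⟩ := exists_count_eq (n := n) (fun b => if b = r then
    n - ∑ b ∈ Finset.univ.erase r, ⌊R b * n⌋₊ else ⌊R b * n⌋₊) (by
      rw [← Finset.add_sum_erase _ _ (Finset.mem_univ r), if_pos rfl,
        Finset.sum_congr rfl fun b hb => if_neg (Finset.ne_of_mem_erase hb)]
      exact Nat.sub_add_cancel hle)
  exact ⟨z, fun b hb => by rw [hz, if_neg hb]⟩

lemma tendsto_empType_of_count_eq_floor {R : β → ℝ} (hR : R ∈ stdSimplex ℝ β) {r : β}
    {z : ∀ n, Fin n → β} (hz : ∀ n b, b ≠ r → count (z n) b = ⌊R b * n⌋₊) :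
    Tendsto (fun n => empType (z n)) atTop (𝓝 R) := by
  have h1 : ∀ b, b ≠ r → Tendsto (fun n => empType (z n) b) atTop (𝓝 (R b)) := by
    intro b hb
    simp only [empType, hz _ b hb]
    exact (tendsto_nat_floor_mul_div_atTop (hR.1 b)).comp tendsto_natCast_atTop_atTop
  refine tendsto_pi_nhds.mpr fun b => ?_
  by_cases hb : b = r
  · subst hb
    have hRr : R b = 1 - ∑ c ∈ Finset.univ.erase b, R c := by
      rw [← hR.2, ← Finset.add_sum_erase _ _ (Finset.mem_univ b)]; ring
    rw [hRr]
    refine Tendsto.congr' ?_ (tendsto_const_nhds.sub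
      (tendsto_finsetSum (Finset.univ.erase b) fun c hc => h1 c (Finset.ne_of_mem_erase hc)))
    filter_upwards [eventually_gt_atTop 0] with n hn
    rw [← (empType_mem_stdSimplex hn (z n)).2, ← Finset.add_sum_erase _ _ (Finset.mem_univ b)]
    ring
  · exact h1 b hb

end Rounding

section Gluing

variable {𝒜 : Type*} [Fintype 𝒜]

lemma exists_gluing {Q Q' : 𝒜 × 𝒜 → ℝ} (hQ : Q ∈ stdSimplex ℝ (𝒜 × 𝒜))
    (hQ' : ∀ p, 0 ≤ Q' p) (h : margY Q = margY Q') :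
    ∃ R ∈ stdSimplex ℝ (𝒜 × 𝒜 × 𝒜),
      (∀ f : 𝒜 × 𝒜 → ℝ, ∑ r, R r * f (r.1, r.2.2) = ∑ p, Q p * f p) ∧
      (∀ f : 𝒜 × 𝒜 → ℝ, ∑ r, R r * f (r.2.1, r.2.2) = ∑ p, Q' p * f p) := by
  have hle : ∀ {T : 𝒜 × 𝒜 → ℝ}, (∀ p, 0 ≤ T p) → ∀ x y, margY T y = 0 → T (x, y) = 0 := by
    intro T hT x y hy
    exact (Finset.sum_eq_zero_iff_of_nonneg fun x _ => hT (x, y)).mp hy x (Finset.mem_univ x)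
  have e1 : ∀ x y, ∑ x', Q (x, y) * Q' (x', y) / margY Q y = Q (x, y) := by
    intro x y
    rw [← Finset.sum_div, ← Finset.mul_sum]
    change Q (x, y) * margY Q' y / margY Q y = _
    rw [← h]
    by_cases hy : margY Q y = 0
    · rw [hle hQ.1 x y hy]; simp
    · rw [mul_div_cancel_right₀ _ hy]
  have e2 : ∀ x' y, ∑ x, Q (x, y) * Q' (x', y) / margY Q y = Q' (x', y) := by
    intro x' y
    rw [← Finset.sum_div, ← Finset.sum_mul]
    change margY Q y * Q' (x', y) / margY Q y = _
    by_cases hy : margY Q y = 0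
    · rw [hle hQ' x' y (h ▸ hy)]; simp
    · rw [mul_div_cancel_left₀ _ hy]
  have hf : ∀ f : 𝒜 × 𝒜 → ℝ, ∑ r : 𝒜 × 𝒜 × 𝒜,
      (Q (r.1, r.2.2) * Q' (r.2.1, r.2.2) / margY Q r.2.2) * f (r.1, r.2.2) = ∑ p, Q p * f p := by
    intro f
    simp only [Fintype.sum_prod_type]
    refine Finset.sum_congr rfl fun x _ => ?_
    rw [Finset.sum_comm]
    refine Finset.sum_congr rfl fun y _ => ?_
    rw [← Finset.sum_mul, e1]
  -- The two inputs are made conditionally independent given the output; division by a zero marginal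
  -- gives 0, as it should.
  refine ⟨fun r => Q (r.1, r.2.2) * Q' (r.2.1, r.2.2) / margY Q r.2.2, ⟨fun r => ?_, ?_⟩, hf, ?_⟩
  · exact div_nonneg (mul_nonneg (hQ.1 _) (hQ' _)) (Finset.sum_nonneg fun _ _ => hQ.1 _)
  · have := hf fun _ => 1
    simp only [mul_one] at this
    rw [this, hQ.2]
  · intro f
    simp only [Fintype.sum_prod_type]
    rw [Finset.sum_comm]
    refine Finset.sum_congr rfl fun x' _ => ?_
    rw [Finset.sum_comm]
    refine Finset.sum_congr rfl fun y _ => ?_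
    rw [← Finset.sum_mul, e2]

end Gluing

section Feasible

variable {𝒜 : Type*} [Fintype 𝒜]

/-- The joint distributions admissible in `Dtilde` for which the divergence is finite. -/
def feasible (d : 𝒜 → 𝒜 → ℝ) (Δ : ℝ) (P : 𝒜 → ℝ) : Set (𝒜 × 𝒜 → ℝ) :=
  {Q | Q ∈ stdSimplex ℝ (𝒜 × 𝒜) ∧ expDist d Q ≤ Δ ∧ ∀ b, P b = 0 → margX Q b = 0}

variable {d : 𝒜 → 𝒜 → ℝ} {Δ : ℝ} {P : 𝒜 → ℝ}

lemma isCompact_feasible (d : 𝒜 → 𝒜 → ℝ) (Δ : ℝ) (P : 𝒜 → ℝ) : IsCompact (feasible d Δ P) := by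
  have h1 : IsClosed {Q : 𝒜 × 𝒜 → ℝ | expDist d Q ≤ Δ} := by
    refine isClosed_le ?_ continuous_const
    unfold expDist; fun_prop
  have h2 : IsClosed {Q : 𝒜 × 𝒜 → ℝ | ∀ b, P b = 0 → margX Q b = 0} := by
    simp only [Set.ofPred_forall]
    refine isClosed_iInter fun b => isClosed_iInter fun _ => isClosed_eq ?_ continuous_const
    unfold margX; fun_prop
  exact (isCompact_stdSimplex ℝ (𝒜 × 𝒜)).inter_right (h1.inter h2)

lemma continuous_margX : Continuous (margX : (𝒜 × 𝒜 → ℝ) → 𝒜 → ℝ) := by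
  unfold margX; fun_prop

lemma continuous_margY : Continuous (margY : (𝒜 × 𝒜 → ℝ) → 𝒜 → ℝ) := by
  unfold margY; fun_prop

lemma margY_mem_stdSimplex {Q : 𝒜 × 𝒜 → ℝ} (hQ : Q ∈ stdSimplex ℝ (𝒜 × 𝒜)) :
    margY Q ∈ stdSimplex ℝ 𝒜 := by
  refine ⟨fun y => Finset.sum_nonneg fun x _ => hQ.1 _, ?_⟩
  rw [← hQ.2, Fintype.sum_prod_type, Finset.sum_comm]
  rfl

lemma Dtilde_margY_le {Q : 𝒜 × 𝒜 → ℝ} (hQ : Q ∈ feasible d Δ P) :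
    Dtilde d Δ (margY Q) P ≤ (klSum (margX Q) P : EReal) := by
  rw [← kl_eq_klSum hQ.2.2]
  exact iInf₂_le Q ⟨hQ.1, rfl, hQ.2.1⟩

lemma exists_feasible_of_Dtilde_lt {PY : 𝒜 → ℝ} {t : ℝ} (h : Dtilde d Δ PY P < (t : EReal)) :
    ∃ Q ∈ feasible d Δ P, margY Q = PY ∧ klSum (margX Q) P < t := by
  simp only [Dtilde, iInf_lt_iff] at h
  obtain ⟨Q, hQ, hlt⟩ := h
  have hs : ∀ b, P b = 0 → margX Q b = 0 := by
    by_contra hs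
    rw [kl, if_neg hs] at hlt
    exact not_top_lt hlt
  rw [kl_eq_klSum hs] at hlt
  exact ⟨Q, ⟨hQ.1, hQ.2.2, hs⟩, hQ.2.1, by exact_mod_cast hlt⟩

end Feasible

/-! ### Approximation of joint laws by sequences -/

section Approximation

variable {𝒜 β : Type*} [Fintype 𝒜] [Fintype β]

lemma sum_mul_indicator_eq_margX [DecidableEq 𝒜] {Q : 𝒜 × 𝒜 → ℝ} {R : β → ℝ} {f g : β → 𝒜}
    (hR : ∀ h : 𝒜 × 𝒜 → ℝ, ∑ r, R r * h (f r, g r) = ∑ p, Q p * h p) (b : 𝒜) :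
    ∑ r, R r * (if f r = b then 1 else 0) = margX Q b := by
  rw [hR fun p => if p.1 = b then 1 else 0, Fintype.sum_prod_type, margX, Finset.sum_comm]
  simp

variable [DecidableEq β]

variable {d : 𝒜 → 𝒜 → ℝ} {Δ : ℝ} {P : 𝒜 → ℝ} {n : ℕ}

/-- Cells other than `r₀` only lose mass and `r₀` costs nothing, so the distortion constraint
survives rounding without slack in `Δ`. -/
lemma seqDist_le_of_rounding (hd : ∀ x y, 0 ≤ d x y) {Q : 𝒜 × 𝒜 → ℝ} (hQ : expDist d Q ≤ Δ)
    {R : β → ℝ} (hR0 : ∀ b, 0 ≤ R b) {f g : β → 𝒜}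
    (hR : ∀ h : 𝒜 × 𝒜 → ℝ, ∑ r, R r * h (f r, g r) = ∑ p, Q p * h p)
    {r₀ : β} (hr₀ : d (f r₀) (g r₀) = 0) {z : Fin n → β}
    (hz : ∀ b, b ≠ r₀ → count z b = ⌊R b * n⌋₊) :
    seqDist d (fun i => f (z i)) (fun i => g (z i)) ≤ n * Δ := by
  have hn : (0 : ℝ) ≤ n := Nat.cast_nonneg n
  calc seqDist d (fun i => f (z i)) (fun i => g (z i))
      = ∑ r, (count z r : ℝ) * d (f r) (g r) := (sum_count_mul z fun r => d (f r) (g r)).symm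
    _ ≤ ∑ r, R r * n * d (f r) (g r) := by
        refine Finset.sum_le_sum fun r _ => ?_
        by_cases hr : r = r₀
        · rw [hr, hr₀]; simp
        · rw [hz r hr]
          exact mul_le_mul_of_nonneg_right (Nat.floor_le (mul_nonneg (hR0 r) hn)) (hd _ _)
    _ = n * ∑ r, R r * d (f r) (g r) := by
        rw [Finset.mul_sum]; exact Finset.sum_congr rfl fun r _ => by ring
    _ = n * expDist d Q := by rw [hR fun p => d p.1 p.2, expDist]
    _ ≤ n * Δ := mul_le_mul_of_nonneg_left hQ hn

variable [DecidableEq 𝒜]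

lemma tendsto_klSum_empType {Q : 𝒜 × 𝒜 → ℝ} {R : β → ℝ} {f g : β → 𝒜} (P : 𝒜 → ℝ)
    (hR : ∀ h : 𝒜 × 𝒜 → ℝ, ∑ r, R r * h (f r, g r) = ∑ p, Q p * h p)
    {z : ∀ n, Fin n → β} (hz : Tendsto (fun n => empType (z n)) atTop (𝓝 R)) :
    Tendsto (fun n => klSum (empType fun i => f (z n i)) P) atTop (𝓝 (klSum (margX Q) P)) := by
  refine ((continuous_klSum P).tendsto (margX Q)).comp (tendsto_pi_nhds.mpr fun b => ?_)
  rw [← sum_mul_indicator_eq_margX hR b]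
  have h : ∀ n, empType (fun i => f (z n i)) b
      = ∑ r, empType (z n) r * (if f r = b then 1 else 0) := by
    intro n
    have h1 := sum_count_mul (z n) fun r => if f r = b then 1 else 0
    have h2 : ((count (fun i => f (z n i)) b : ℕ) : ℝ) = ∑ i, if f (z n i) = b then 1 else 0 := by
      simp [count]
    rw [empType, h2, ← h1, Finset.sum_div]
    refine Finset.sum_congr rfl fun r _ => ?_
    rw [empType]; ring
  simp only [h]
  exact tendsto_finsetSum _ fun r _ => (tendsto_pi_nhds.mp hz r).mul_const _

lemma support_of_rounding {Q : 𝒜 × 𝒜 → ℝ} (hQ : ∀ b, P b = 0 → margX Q b = 0)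
    {R : β → ℝ} (hR0 : ∀ b, 0 ≤ R b) {f g : β → 𝒜}
    (hR : ∀ h : 𝒜 × 𝒜 → ℝ, ∑ r, R r * h (f r, g r) = ∑ p, Q p * h p)
    {r₀ : β} (hr₀ : P (f r₀) ≠ 0) {z : Fin n → β}
    (hz : ∀ b, b ≠ r₀ → count z b = ⌊R b * n⌋₊) (i : Fin n) : P (f (z i)) ≠ 0 := by
  by_cases hi : z i = r₀
  · rwa [hi]
  · intro h0
    have h1 := sum_mul_indicator_eq_margX hR (f (z i))
    rw [hQ _ h0, Finset.sum_eq_zero_iff_of_nonneg fun r _ =>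
      mul_nonneg (hR0 r) (by split_ifs <;> norm_num)] at h1
    have h2 := h1 (z i) (Finset.mem_univ _)
    rw [if_pos rfl, mul_one] at h2
    have h3 := count_apply_pos z i
    rw [hz _ hi, h2] at h3
    simp at h3

lemma single_mem_feasible (hΔ : 0 ≤ Δ) {b : 𝒜} (hd : d b b = 0) (hP : P b ≠ 0) :
    Pi.single (b, b) 1 ∈ feasible d Δ P := by
  refine ⟨single_mem_stdSimplex ℝ _, ?_, fun c hc => ?_⟩
  · rw [expDist, Finset.sum_eq_single (b, b)]
    · simpa [hd]
    · intro p _ hp; simp [Pi.single_eq_of_ne hp]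
    · simp
  · have hcb : c ≠ b := fun h => hP (h ▸ hc)
    exact Finset.sum_eq_zero fun y _ => Pi.single_eq_of_ne (by simp [hcb]) _

end Approximation

/-! ### Passage to exponents -/

section Limit

lemma tendsto_log_polyFactor (k : ℕ) :
    Tendsto (fun n : ℕ => Real.log (polyFactor k n) / n) atTop (𝓝 0) := by
  have h1 : Tendsto (fun n : ℕ => Real.log ((n : ℝ) + 1) / n) atTop (𝓝 0) := by
    -- The limit of `log x / (x - 1)`, taken at `x = n + 1`.
    have h := (Real.tendsto_pow_log_div_mul_add_atTop 1 (-1) 1 one_ne_zero).comp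
      (tendsto_natCast_atTop_atTop.comp (tendsto_add_atTop_nat 1))
    refine h.congr fun n => ?_
    simp
  have h2 : Tendsto (fun n : ℕ => (1 : ℝ) / n) atTop (𝓝 0) := tendsto_one_div_atTop_nhds_zero_nat
  have h3 := ((h2.add h1).const_mul (k : ℝ))
  rw [add_zero, mul_zero] at h3
  refine h3.congr fun n => ?_
  have : (0 : ℝ) < n + 1 := by positivity
  rw [polyFactor, Real.log_pow, Real.log_mul (Real.exp_pos 1).ne' this.ne', Real.log_exp]
  ring

lemma tendsto_exponent {u M : ℕ → ℝ} {e : ℝ} (k l : ℕ)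
    (hle : ∀ n, 0 < n → u n ≤ polyFactor k n * Real.exp (-(n * e)))
    (hge : ∀ n, 0 < n → Real.exp (-(n * M n)) ≤ polyFactor l n * u n)
    (hM : Tendsto M atTop (𝓝 e)) :
    Tendsto (fun n : ℕ => -(1 / (n : ℝ) * Real.log (u n))) atTop (𝓝 e) := by
  have hl : Tendsto (fun n : ℕ => e - Real.log (polyFactor k n) / n) atTop (𝓝 e) := by
    simpa using tendsto_const_nhds.sub (tendsto_log_polyFactor k)
  have hu : Tendsto (fun n : ℕ => M n + Real.log (polyFactor l n) / n) atTop (𝓝 e) := by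
    simpa using hM.add (tendsto_log_polyFactor l)
  have hpos : ∀ n, 0 < n → 0 < u n := fun n hn =>
    pos_of_mul_pos_right ((Real.exp_pos _).trans_le (hge n hn)) (polyFactor_pos l n).le
  refine tendsto_of_tendsto_of_tendsto_of_le_of_le' hl hu ?_ ?_
  · filter_upwards [eventually_gt_atTop 0] with n hn
    have hn' : (0 : ℝ) < n := by positivity
    have h := Real.log_le_log (hpos n hn) (hle n hn)
    rw [Real.log_mul (polyFactor_pos k n).ne' (Real.exp_pos _).ne', Real.log_exp] at h
    have h2 := div_le_div_of_nonneg_right h hn'.le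
    rw [add_div, neg_div, mul_div_cancel_left₀ _ hn'.ne'] at h2
    rw [one_div, inv_mul_eq_div]
    linarith
  · filter_upwards [eventually_gt_atTop 0] with n hn
    have hn' : (0 : ℝ) < n := by positivity
    have h := Real.log_le_log (Real.exp_pos _) (hge n hn)
    rw [Real.log_mul (polyFactor_pos l n).ne' (hpos n hn).ne', Real.log_exp] at h
    have h2 := div_le_div_of_nonneg_right h hn'.le
    rw [add_div, neg_div, mul_div_cancel_left₀ _ hn'.ne'] at h2
    rw [one_div, inv_mul_eq_div]
    linarith

end Limit

/-! ### The min-max problem as a minimum over pairs of joint laws -/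

section Game

variable {𝒜 : Type*} [Fintype 𝒜]

/-- Pairs of joint distributions, one for each hypothesis, that produce the same output law. -/
def jointlyFeasible (d : 𝒜 → 𝒜 → ℝ) (Δ₀ Δ₁ : ℝ) (P₀ P₁ : 𝒜 → ℝ) :
    Set ((𝒜 × 𝒜 → ℝ) × (𝒜 × 𝒜 → ℝ)) :=
  (feasible d Δ₁ P₁ ×ˢ feasible d Δ₀ P₀) ∩ {q | margY q.1 = margY q.2}

/-- The exponent achieved by a pair of joint distributions. -/
noncomputable def exponent (a : ℝ) (P₀ P₁ : 𝒜 → ℝ) (q : (𝒜 × 𝒜 → ℝ) × (𝒜 × 𝒜 → ℝ)) : ℝ :=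
  max (klSum (margX q.1) P₁) (klSum (margX q.2) P₀ - a)

variable {d : 𝒜 → 𝒜 → ℝ} {Δ₀ Δ₁ a : ℝ} {P₀ P₁ : 𝒜 → ℝ}

/-- If the maximum were smaller, both infima would have witnesses below the value; they share the
marginal `PY`, hence form a feasible pair beating `q`. Attainment of the inner infima is not needed.
-/
lemma exponent_le_max_Dtilde {q : (𝒜 × 𝒜 → ℝ) × (𝒜 × 𝒜 → ℝ)}
    (hq : IsMinOn (exponent a P₀ P₁) (jointlyFeasible d Δ₀ Δ₁ P₀ P₁) q) (PY : 𝒜 → ℝ) :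
    (exponent a P₀ P₁ q : EReal)
      ≤ max (Dtilde d Δ₁ PY P₁) (Dtilde d Δ₀ PY P₀ - (a : EReal)) := by
  by_contra hlt
  rw [not_le, max_lt_iff] at hlt
  obtain ⟨Q₁, hQ₁, hY₁, hlt₁⟩ := exists_feasible_of_Dtilde_lt hlt.1
  have h0 : Dtilde d Δ₀ PY P₀ < ((exponent a P₀ P₁ q + a : ℝ) : EReal) := by
    have := hlt.2
    rw [EReal.sub_lt_iff (by simp) (by simp)] at this
    exact_mod_cast this
  obtain ⟨Q₀, hQ₀, hY₀, hlt₀⟩ := exists_feasible_of_Dtilde_lt h0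
  have hmin : exponent a P₀ P₁ q ≤ exponent a P₀ P₁ (Q₁, Q₀) :=
    isMinOn_iff.mp hq (Q₁, Q₀) ⟨⟨hQ₁, hQ₀⟩, hY₁.trans hY₀.symm⟩
  exact absurd hmin (not_le.mpr (max_lt hlt₁ (by linarith)))

lemma isLeast_exponent {q : (𝒜 × 𝒜 → ℝ) × (𝒜 × 𝒜 → ℝ)}
    (hmem : q ∈ jointlyFeasible d Δ₀ Δ₁ P₀ P₁)
    (hq : IsMinOn (exponent a P₀ P₁) (jointlyFeasible d Δ₀ Δ₁ P₀ P₁) q) :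
    IsLeast ((fun PY : 𝒜 → ℝ => max (Dtilde d Δ₁ PY P₁)
      (Dtilde d Δ₀ PY P₀ - (a : EReal))) '' stdSimplex ℝ 𝒜) (exponent a P₀ P₁ q : EReal) := by
  refine ⟨⟨margY q.1, margY_mem_stdSimplex hmem.1.1.1, le_antisymm ?_
    (exponent_le_max_Dtilde hq _)⟩, ?_⟩
  · rw [exponent, EReal.coe_strictMono.monotone.map_max, EReal.coe_sub]
    refine max_le_max (Dtilde_margY_le hmem.1.1) (EReal.sub_le_sub ?_ le_rfl)
    rw [show margY q.1 = margY q.2 from hmem.2]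
    exact Dtilde_margY_le hmem.1.2
  · rintro _ ⟨PY, -, rfl⟩
    exact exponent_le_max_Dtilde hq PY

variable [DecidableEq 𝒜]

lemma exists_isMinOn_exponent (hd_self : ∀ x, d x x = 0) (hΔ₀ : 0 ≤ Δ₀) (hΔ₁ : 0 ≤ Δ₁)
    (hP : ∃ x, P₀ x ≠ 0 ∧ P₁ x ≠ 0) :
    ∃ q ∈ jointlyFeasible d Δ₀ Δ₁ P₀ P₁,
      IsMinOn (exponent a P₀ P₁) (jointlyFeasible d Δ₀ Δ₁ P₀ P₁) q := by
  obtain ⟨b, h₀, h₁⟩ := hP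
  have hne : (jointlyFeasible d Δ₀ Δ₁ P₀ P₁).Nonempty :=
    ⟨(Pi.single (b, b) 1, Pi.single (b, b) 1),
      ⟨single_mem_feasible hΔ₁ (hd_self b) h₁, single_mem_feasible hΔ₀ (hd_self b) h₀⟩, rfl⟩
  refine IsCompact.exists_isMinOn ?_ hne ?_
  · exact ((isCompact_feasible d Δ₁ P₁).prod (isCompact_feasible d Δ₀ P₀)).inter_right
      (isClosed_eq (continuous_margY.comp continuous_fst) (continuous_margY.comp continuous_snd))
  · refine Continuous.continuousOn ?_
    exact ((continuous_klSum P₁).comp (continuous_margX.comp continuous_fst)).max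
      (((continuous_klSum P₀).comp (continuous_margX.comp continuous_snd)).sub continuous_const)

lemma exists_exponent_lower_bound (hd : ∀ x y, 0 ≤ d x y) (hd_self : ∀ x, d x x = 0)
    (hP₀ : ∀ b, 0 ≤ P₀ b) (hP₁ : ∀ b, 0 ≤ P₁ b) (hP : ∃ x, P₀ x ≠ 0 ∧ P₁ x ≠ 0)
    {q : (𝒜 × 𝒜 → ℝ) × (𝒜 × 𝒜 → ℝ)} (hq : q ∈ jointlyFeasible d Δ₀ Δ₁ P₀ P₁) :
    ∃ M : ℕ → ℝ, Tendsto M atTop (𝓝 (exponent a P₀ P₁ q)) ∧ ∀ n : ℕ, 0 < n →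
      Real.exp (-(n * M n)) ≤ polyFactor (Fintype.card 𝒜 + Fintype.card (𝒜 × 𝒜)) n *
        equilibriumPayoff d Δ₀ Δ₁ a P₀ P₁ n := by
  obtain ⟨b, hb₀, hb₁⟩ := hP
  obtain ⟨⟨h₁, h₀⟩, hY⟩ := hq
  obtain ⟨R, hR, hR₁, hR₀⟩ := exists_gluing h₁.1 h₀.1.1 hY
  -- The remainder goes to `(b, b, b)`: it has zero distortion for both pairs, and `b` is in both
  -- supports.
  choose z hz using exists_rounding hR (b, b, b)
  have hlim := tendsto_empType_of_count_eq_floor hR hz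
  refine ⟨fun n => max (klSum (empType fun i => (z n i).1) P₁)
    (klSum (empType fun i => (z n i).2.1) P₀ - a), ?_, fun n hn => ?_⟩
  · have t₁ := tendsto_klSum_empType (f := fun r => r.1) (g := fun r => r.2.2) P₁ hR₁ hlim
    have t₀ := tendsto_klSum_empType (f := fun r => r.2.1) (g := fun r => r.2.2) P₀ hR₀ hlim
    exact t₁.max (t₀.sub_const a)
  · rw [polyFactor, pow_add]
    exact exp_le_equilibriumPayoff (y := fun i => (z n i).2.2) hn hP₀ hP₁
      (seqDist_le_of_rounding (f := fun r => r.2.1) (g := fun r => r.2.2) hd h₀.2.1 hR.1 hR₀ (hd_self b) (hz n))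
      (seqDist_le_of_rounding (f := fun r => r.1) (g := fun r => r.2.2) hd h₁.2.1 hR.1 hR₁ (hd_self b) (hz n))
      (support_of_rounding (f := fun r => r.2.1) (g := fun r => r.2.2) h₀.2.2 hR.1 hR₀ hb₀ (hz n))
      (support_of_rounding (f := fun r => r.1) (g := fun r => r.2.2) h₁.2.2 hR.1 hR₁ hb₁ (hz n))

end Game

/-- Absorbs the factor 2 that comes from adding the two error terms. -/
lemma two_mul_polyFactor_le (k n : ℕ) : 2 * polyFactor k n ≤ polyFactor (k + 1) n := by
  have h : 2 ≤ Real.exp 1 * (n + 1) := by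
    nlinarith [Real.add_one_le_exp (1 : ℝ), Nat.cast_nonneg (α := ℝ) n]
  rw [polyFactor, polyFactor, pow_succ, mul_comm]
  gcongr

end DetectionGame

theorem theorem7 {𝒜 : Type*} [Fintype 𝒜] [DecidableEq 𝒜]
    (d : 𝒜 → 𝒜 → ℝ) (hd : ∀ x y, 0 ≤ d x y) (hd_self : ∀ x, d x x = 0)
    (Δ₀ Δ₁ : ℝ) (hΔ₀ : 0 ≤ Δ₀) (hΔ₁ : 0 ≤ Δ₁) (a : ℝ)
    (P₀ P₁ : 𝒜 → ℝ) (hP₀ : P₀ ∈ stdSimplex ℝ 𝒜) (hP₁ : P₁ ∈ stdSimplex ℝ 𝒜)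
    (hP : ∃ x, P₀ x ≠ 0 ∧ P₁ x ≠ 0) :
    (∀ n : ℕ, 0 < n → 0 < DetectionGame.equilibriumPayoff d Δ₀ Δ₁ a P₀ P₁ n) ∧
    ∃ e : ℝ,
      IsLeast ((fun PY : 𝒜 → ℝ =>
          max (DetectionGame.Dtilde d Δ₁ PY P₁)
            (DetectionGame.Dtilde d Δ₀ PY P₀ - (a : EReal))) '' stdSimplex ℝ 𝒜) (e : EReal) ∧
      Tendsto
        (fun n : ℕ =>
          -(1 / (n : ℝ) * Real.log (DetectionGame.equilibriumPayoff d Δ₀ Δ₁ a P₀ P₁ n)))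
        atTop (𝓝 e) := by
  obtain ⟨q, hmem, hq⟩ := DetectionGame.exists_isMinOn_exponent (a := a) hd_self hΔ₀ hΔ₁ hP
  obtain ⟨M, hM, hge⟩ :=
    DetectionGame.exists_exponent_lower_bound (a := a) hd hd_self hP₀.1 hP₁.1 hP hmem
  refine ⟨fun n hn => pos_of_mul_pos_right ((Real.exp_pos _).trans_le (hge n hn))
    (DetectionGame.polyFactor_pos _ n).le, _, DetectionGame.isLeast_exponent hmem hq, ?_⟩
  refine DetectionGame.tendsto_exponent (Fintype.card 𝒜 + 1) _ (fun n hn => ?_) hge hM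
  refine (DetectionGame.equilibriumPayoff_le hn hP₀.1 hP₁.1 fun PY _ =>
    DetectionGame.exponent_le_max_Dtilde hq PY).trans ?_
  exact mul_le_mul_of_nonneg_right (DetectionGame.two_mul_polyFactor_le _ n) (Real.exp_pos _).le
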